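/- **DC power-grid model.** Let $\mathcal G=(\mathcal V,\mathcal E)$ be a finite simple graph (buses and connected lines) with line susceptances $B=(B_{e})_{e\in\mathcal E}\in\mathbb R^{\mathcal E}$ and a reference bus $r\in\mathcal V$ with $\theta_r=0$; the state is $x=(\theta_v)_{v\ne r}$. A line flow sensor $(i,j)$ measures $B_{ij}(\theta_i-\theta_j)$ if $\{i,j\}\in\mathcal E$ and $0$ otherwise; an injection sensor at bus $i$ measures the sum of all outgoing line flows $\sum_{j:\{i,j\}\in\mathcal E}B_{ij}(\theta_i-\theta_j)$. Let $\mathcal S$ be the set of deployed sensors (at most one injection sensor per bus, and at most one flow sensor per line and direction), let $H$ be the measurement matrix (noiseless measurements are $Hx$), and for $\mathcal T\subset\mathcal S$ let $H_{\mathcal T}$ consist of the rows of $H$ in $\mathcal T$. The system with sensors $\mathcal T$ is *observable* if $H_{\mathcal T}$ has full column rank. State variables in $\mathcal X$ are *observable with respect to* $\mathcal T$ if every element of the null space of $H_{\mathcal T}$ vanishes on $\mathcal X$. If so, $\mathcal C\subset\mathcal T$ is *critical with respect to* $(\mathcal T,\mathcal X)$ if $\mathcal X$ is not observable with respect to $\mathcal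 T\setminus\mathcal C$, but is observable with respect to $\mathcal T\setminus\mathcal D$ for every $\mathcal D\subsetneq\mathcal C$. An attack $a\in\mathbb R^{\mathcal S}$ supported on the attacked sensors is *unobservable* if for every state $x$ and noise $e$ there is a state $\bar x\neq x$ with $(Hx+e)+a=H\bar x+e$. For $\mathcal S_o\subset\mathcal S$ let $H_o=H_{\mathcal S_o}$ and let $\mathcal X_o$ be the set of state variables whose columns in $H_o$ are nonzero. The *reduced network* $\bar{\mathcal G}=(\bar{\mathcal V},\bar{\mathcal E})$ of $\mathcal S_o$ has as lines the $\{i,j\}\in\mathcal E$ such that $\mathcal S_o$ contains a line flow sensor on $\{i,j\}$ or an injection sensor at $i$ or $j$, and $\bar{\mathcal V}$ consists of the endpoints of these lines. **Statement.** For every topology $\mathcal G$ there is a nonzero real polynomial $P$ in the line susceptances such that the following holds for all $B\in\mathbb R^{\mathcal E}$ with $P(B)\ne0$ (so for all susceptances outside a proper algebraic subset, which is Lebesgue-null), and for all $r$, $\mathcal S$ such that the system with sensors $\mathcal S$ is observable, and all $\mathcal C\subset\mathcal S_o\subset\mathcal S$ with $r\in\bar{\mathcal V}$. Suppose that 1.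 there is a cut $(\mathcal U,\mathcal V\setminus\mathcal U)$ of $\mathcal G$, both sides nonempty, such that $\mathcal C$ consists of exactly those sensors of $\mathcal S$ that are line flow sensors on the lines of the cut or injection sensors at endpoints of lines of the cut; and 2. for every $s\in\mathcal C$, each injection sensor in $(\mathcal S_o\setminus\mathcal C)\cup\{s\}$ can be assigned to a line incident to its bus such that some spanning tree of $\bar{\mathcal G}$ has on every edge at least one sensor of $(\mathcal S_o\setminus\mathcal C)\cup\{s\}$ (a line flow sensor or an assigned injection sensor). Then: (a) the variables in $\mathcal X_o$ are observable with respect to $\mathcal S_o$; $\mathcal C$ is a critical set with respect to $(\mathcal S_o,\mathcal X_o)$; and removing $\mathcal C$ from $\mathcal S$ makes the system unobservable. (b) The space $\mathcal A_o$ of vectors in the column space of $H_o$ whose entries at $\mathcal S_o\setminus\mathcal C$ are zero has dimension one, and for every nonzero $b\in\mathcal A_o$ the attack that adds the corresponding entries of $b$ to the data of the sensors in $\mathcal C$ is unobservable. (c) Let $U_o$ be any matrix whose columns form a basis of the column space of $H_o$, and let $\bar U_o$ be obtained from it by removing the rows of the sensors in $\mathcal C$. Then $U_o$ has $|\mathcal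 X_o|$ columns, the null space of $\bar U_o$ has dimension one, and for every nonzero $v$ in it the attack that adds the corresponding entries of $U_ov$ to the data of the sensors in $\mathcal C$ is unobservable. -/

import Mathlib

section MeasurementModel

/-! The linear measurement model `z = H x + e`. The type `σ` indexes sensor locations and `ι` indexes
state variables; a system deploys a set `S` of sensors, whose measurement matrix consists of the
rows of `H` in `S`. -/

variable {σ ι : Type*}

/-- The submatrix of `H` that retains the rows of the sensors in `S`. -/
def rowsOf (H : Matrix σ ι ℝ) (S : Set σ) : Matrix S ι ℝ :=
  H.submatrix Subtype.val id

/-- The system with sensors `S` is observable: the measurement matrix has full column rank, that is,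
the state `x` is uniquely determined by the noiseless measurements. -/
def IsObservable [Fintype ι] (H : Matrix σ ι ℝ) (S : Set σ) : Prop :=
  Function.Injective (rowsOf H S).mulVec

/-- The state variables in `X` are observable with respect to the sensors in `S`. -/
def IsObservableVars [Fintype ι] (H : Matrix σ ι ℝ) (X : Set ι) (S : Set σ) : Prop :=
  ∀ x : ι → ℝ, (rowsOf H S).mulVec x = 0 → ∀ i ∈ X, x i = 0

/-- `C` is a critical set with respect to `(S, X)`. -/
def IsCriticalSetFor [Fintype ι] (H : Matrix σ ι ℝ) (S : Set σ) (X : Set ι) (C : Set σ) : Prop :=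
  C ⊆ S ∧ IsObservableVars H X S ∧ ¬ IsObservableVars H X (S \ C) ∧
    ∀ D : Set σ, D ⊂ C → IsObservableVars H X (S \ D)

/-- The state variables that affect the measurements of the sensors in `S`: the nonzero columns of
the submatrix of `H` with rows in `S`. -/
def relevantVars (H : Matrix σ ι ℝ) (S : Set σ) : Set ι :=
  {i | ∃ s ∈ S, H s i ≠ 0}

/-- `a` is an unobservable attack, with adversary sensors `A`, on the system with sensors `S`: it is
supported on `A`, and whatever the state `x` and the noise `e` are, the corrupted measurement is
the one that a state different from `x` produces with the same noise. -/
def IsUnobservableAttack [Fintype ι] (H : Matrix σ ι ℝ) (S A : Set σ) (a : S → ℝ) : Prop :=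
  (∀ s : S, (s : σ) ∉ A → a s = 0) ∧
    ∀ (x : ι → ℝ) (e : S → ℝ), ∃ y : ι → ℝ, y ≠ x ∧
      ((rowsOf H S).mulVec x + e) + a = (rowsOf H S).mulVec y + e

/-- The column space of the matrix with rows in `S`. -/
def measurementSubspace [Fintype ι] (H : Matrix σ ι ℝ) (S : Set σ) : Submodule ℝ (S → ℝ) :=
  LinearMap.range (rowsOf H S).mulVecLin

/-- The vectors of the column space of the partial measurement matrix (rows in `S`) whose entries at
the sensors of `S \ C` are zero. -/
def partialAttackSpace [Fintype ι] (H : Matrix σ ι ℝ) (S C : Set σ) : Submodule ℝ (S → ℝ) where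
  carrier := {b | b ∈ measurementSubspace H S ∧ ∀ s : S, (s : σ) ∉ C → b s = 0}
  zero_mem' := ⟨Submodule.zero_mem _, fun _ _ => rfl⟩
  add_mem' := fun ha hb => ⟨Submodule.add_mem _ ha.1 hb.1, fun s hs => by
    simp [ha.2 s hs, hb.2 s hs]⟩
  smul_mem' := fun c a ha => ⟨Submodule.smul_mem _ c ha.1, fun s hs => by
    simp [ha.2 s hs]⟩

open Classical in
/-- The attack on the whole system (sensors `S`) that adds to the data of each sensor in `C` the
corresponding entry of the vector `b` indexed by the sensors in `T`, and changes nothing else. -/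
noncomputable def attackOn (S T C : Set σ) (b : T → ℝ) : S → ℝ :=
  fun s => if h : (s : σ) ∈ T ∧ (s : σ) ∈ C then b ⟨s, h.1⟩ else 0

/-- `U` is a basis matrix of the subspace `R`: its columns form a basis of `R`. -/
def IsBasisMatrix {τ κ : Type*} (U : Matrix τ κ ℝ) (R : Submodule ℝ (τ → ℝ)) : Prop :=
  LinearIndependent ℝ U.col ∧ Submodule.span ℝ (Set.range U.col) = R

end MeasurementModel

section PowerGrid

variable {V : Type*}

/-- Sensors of a power grid with bus set `V`: the injection sensor at bus `i`, and the sensor that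
measures the line flow from bus `i` to bus `j`. -/
inductive Sensor (V : Type*) where
  | inj (i : V) : Sensor V
  | flow (i j : V) : Sensor V

variable [Fintype V] [DecidableEq V]

/-- The coefficient of the phase angle of bus `v` in the line flow from `i` to `j`, which is
`B_ij (θ_i - θ_j)` if there is a connected line `{i, j}` and zero otherwise. -/
def flowCoeff (G : SimpleGraph V) [DecidableRel G.Adj] (B : G.edgeSet → ℝ) (i j v : V) : ℝ :=
  if h : G.Adj i j then
    B ⟨s(i, j), h⟩ * ((if v = i then 1 else 0) - (if v = j then 1 else 0))
  else 0

/-- The DC measurement matrix of the grid with topology `G`, line susceptances `B` and reference bus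
`r`. The state consists of the phase angles of all buses other than `r`, the phase angle of `r` being
zero. An injection sensor measures the sum of all outgoing line flows. -/
def dcMatrix (G : SimpleGraph V) [DecidableRel G.Adj] (B : G.edgeSet → ℝ) (r : V) :
    Matrix (Sensor V) {v : V // v ≠ r} ℝ :=
  fun s v => match s with
    | Sensor.inj i => ∑ j, flowCoeff G B i j v
    | Sensor.flow i j => flowCoeff G B i j v

end PowerGrid

section Topology

variable {V : Type*}

/-- `{i, j}` is a line of the cut `(U, Uᶜ)`. -/
def IsCutLine (G : SimpleGraph V) (U : Set V) (i j : V) : Prop :=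
  G.Adj i j ∧ (i ∈ U ∧ j ∉ U ∨ i ∉ U ∧ j ∈ U)

/-- Among the sensors in `S`, those on the lines of the cut `(U, Uᶜ)` and the injection sensors at
the endpoints of these lines. -/
def cutSensors (G : SimpleGraph V) (S : Set (Sensor V)) (U : Set V) : Set (Sensor V) :=
  {s | s ∈ S ∧ match s with
    | Sensor.inj i => ∃ j, IsCutLine G U i j
    | Sensor.flow i j => IsCutLine G U i j}

/-- `{i, j}` is a line of the reduced network for the sensors `T`. -/
def ReducedAdj (G : SimpleGraph V) (T : Set (Sensor V)) (i j : V) : Prop :=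
  G.Adj i j ∧ (Sensor.flow i j ∈ T ∨ Sensor.flow j i ∈ T ∨ Sensor.inj i ∈ T ∨ Sensor.inj j ∈ T)

/-- The topology of the reduced network for the sensors `T`. -/
def reducedNetwork (G : SimpleGraph V) (T : Set (Sensor V)) : G.Subgraph where
  verts := {i | ∃ j, ReducedAdj G T i j}
  Adj := ReducedAdj G T
  adj_sub := fun h => h.1
  edge_vert := fun h => ⟨_, h⟩
  symm := ⟨fun _ _ h => ⟨h.1.symm, by have := h.2; tauto⟩⟩

/-- The injection sensors in `Q` can be assigned to lines incident to their buses such that some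
spanning tree of the network `N` has a sensor of `Q` (a line flow sensor or an assigned injection
sensor) on each of its edges. -/
def HasMeasuredSpanningTree (G : SimpleGraph V) (N : G.Subgraph) (Q : Set (Sensor V)) : Prop :=
  ∃ a : V → Sym2 V, (∀ k, Sensor.inj k ∈ Q → a k ∈ G.incidenceSet k) ∧
    ∃ T : G.Subgraph, T ≤ N ∧ T.verts = N.verts ∧ T.coe.IsTree ∧
      ∀ i j, T.Adj i j →
        Sensor.flow i j ∈ Q ∨ Sensor.flow j i ∈ Q ∨ ∃ k, Sensor.inj k ∈ Q ∧ a k = s(i, j)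

end Topology

/-! Two independent facts drive the proof. First, shifting the phase angles on the side of the cut
away from the reference bus changes only the flows across the cut, so it is invisible to `S \ C`.
Observability of `S` then forces some sensor of `C` to see it.

Second, for generic susceptances, `So \ C` together with any one sensor of `C` determines the
variables of `So`. Trivial kernel is a polynomial condition on the susceptances, so it holds
generically once it holds at one point; that point is one on a measured spanning tree and zero on
all other lines. There, the tree edges with nonzero flow form a forest, and each is assigned to an
endpoint whose injection sensor reads zero. Such an endpoint cannot be a leaf, which
`SimpleGraph.IsAcyclic.not_adj_of_assignment` excludes.

Linear algebra does the rest (`partial_measurement_attack`): an attack vector is fixed by its entry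
at one sensor of `C` that sees the shift, so all attack vectors are multiples of the image of the
shift. -/

/-- In a finite forest, the edges cannot be assigned injectively to endpoints in such a way that no
edge is assigned to a leaf. -/
theorem SimpleGraph.IsAcyclic.not_adj_of_assignment {W : Type*} [Finite W] {F : SimpleGraph W}
    (hF : F.IsAcyclic) (A : W → W → Prop) (hcover : ∀ i j, F.Adj i j → A i j ∨ A j i)
    (hinj : ∀ k i j, A k i → A k j → i = j)
    (hdeg : ∀ k j, F.Adj k j → A k j → ∃ i, i ≠ j ∧ F.Adj k i) (i j : W) : ¬ F.Adj i j := by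
  intro hij
  -- There are paths of every length whose first edge is assigned to their starting vertex `k`. As
  -- `k` is not a leaf, a second edge leaves it; acyclicity makes this edge extend the path, and
  -- injectivity assigns it to its other end.
  have key : ∀ n : ℕ, ∃ (u k j : W) (h : F.Adj k j) (p : F.Walk j u),
      (SimpleGraph.Walk.cons h p).IsPath ∧ A k j ∧ p.length = n := by
    intro n
    induction n with
    | zero =>
      rcases hcover i j hij with h | h
      · exact ⟨j, i, j, hij, .nil, by simpa using hij.ne, h, rfl⟩
      · exact ⟨i, j, i, hij.symm, .nil, by simpa using hij.ne', h, rfl⟩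
    | succ n ih =>
      obtain ⟨u, k, j, h, p, hp, hA, hn⟩ := ih
      obtain ⟨i, hi, hki⟩ := hdeg k j h hA
      refine ⟨u, i, k, hki.symm, .cons h p, ?_, ?_, by simp [hn]⟩
      · refine hp.cons fun hmem => hi ?_
        simpa using hF.eq_snd_of_adj_start hp hki hmem
      · exact (hcover k i hki).resolve_left fun h' => hi (hinj k i j h' hA)
  have := Fintype.ofFinite W
  obtain ⟨u, k, j, h, p, hp, -, hn⟩ := key (Fintype.card W)
  have := hp.length_lt
  simp only [SimpleGraph.Walk.length_cons] at this
  omega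

/-! ### Trivial kernel as a generic property -/

theorem Matrix.det_transpose_mul_self_ne_zero_iff {m n : Type*} [Fintype m] [Fintype n]
    [DecidableEq n] (M : Matrix m n ℝ) :
    (M.transpose * M).det ≠ 0 ↔ ∀ x, M.mulVec x = 0 → x = 0 := by
  rw [Ne, ← Matrix.exists_mulVec_eq_zero_iff]
  have h := fun x => Matrix.conjTranspose_mul_self_mulVec_eq_zero M x
  simp only [Matrix.conjTranspose_eq_transpose_of_trivial] at h
  simp only [h]
  push Not
  exact ⟨fun H x hx => by_contra fun hne => H x hne hx, fun H x hne hx => hne (H x hx)⟩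

/-- The matrices of a polynomial family have trivial kernel outside a proper algebraic set, provided
that one of them has. -/
theorem exists_polynomial_forall_ker_trivial {m n τ : Type*} [Fintype m] [Fintype n]
    (M : (τ → ℝ) → Matrix m n ℝ)
    (hM : ∀ i j, ∃ p : MvPolynomial τ ℝ, ∀ B, MvPolynomial.eval B p = M B i j) :
    ∃ P : MvPolynomial τ ℝ, P ≠ 0 ∧ ∀ B, MvPolynomial.eval B P ≠ 0 →
      ∀ B₀, (∀ x, (M B₀).mulVec x = 0 → x = 0) → ∀ x, (M B).mulVec x = 0 → x = 0 := by
  classical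
  choose p hp using hM
  let N : Matrix m n (MvPolynomial τ ℝ) := Matrix.of p
  have hN : ∀ B, N.map (MvPolynomial.eval B) = M B := fun B => by
    ext i j
    exact hp i j B
  have hdet : ∀ B, MvPolynomial.eval B (N.transpose * N).det = ((M B).transpose * M B).det := by
    intro B
    rw [RingHom.map_det, RingHom.mapMatrix_apply, Matrix.map_mul, ← hN B]
    rfl
  -- If the Gram determinant vanishes identically, no `B₀` has trivial kernel, and the constant `1`
  -- serves vacuously.
  by_cases h0 : (N.transpose * N).det = 0
  · refine ⟨1, one_ne_zero, fun B _ B₀ h => ?_⟩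
    rw [← Matrix.det_transpose_mul_self_ne_zero_iff, ← hdet, h0] at h
    simp at h
  · refine ⟨_, h0, fun B hB _ _ => ?_⟩
    rwa [← Matrix.det_transpose_mul_self_ne_zero_iff, ← hdet]

/-! ### Line flows and measurements in terms of phase angles -/

section

variable {V : Type*} [Fintype V] [DecidableEq V]

instance Sensor.finite : Finite (Sensor V) :=
  Finite.of_surjective (fun x : V ⊕ V × V => x.elim Sensor.inj fun p => Sensor.flow p.1 p.2)
    fun s => match s with
      | .inj i => ⟨.inl i, rfl⟩
      | .flow i j => ⟨.inr (i, j), rfl⟩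

variable (G : SimpleGraph V) [DecidableRel G.Adj] (B : G.edgeSet → ℝ) {r : V}

/-- The phase angles of all buses, the one of the reference bus being zero. -/
def phaseAngle (x : {v : V // v ≠ r} → ℝ) (v : V) : ℝ :=
  if h : v = r then 0 else x ⟨v, h⟩

omit [Fintype V] in
@[simp]
theorem phaseAngle_ref (x : {v : V // v ≠ r} → ℝ) : phaseAngle x r = 0 := by
  simp [phaseAngle]

omit [Fintype V] in
@[simp]
theorem phaseAngle_val (x : {v : V // v ≠ r} → ℝ) (v : {v : V // v ≠ r}) :
    phaseAngle x v = x v := by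
  simp [phaseAngle, v.2]

/-- The flow on the line from `i` to `j` for the phase angles `θ`. -/
def lineFlow (θ : V → ℝ) (i j : V) : ℝ :=
  if h : G.Adj i j then B ⟨s(i, j), h⟩ * (θ i - θ j) else 0

theorem sum_flowCoeff_mul (x : {v : V // v ≠ r} → ℝ) (i j : V) :
    ∑ v, flowCoeff G B i j (v : {v : V // v ≠ r}) * x v = lineFlow G B (phaseAngle x) i j := by
  have key : ∀ i : V, ∑ v : {v : V // v ≠ r}, (if v.1 = i then (1 : ℝ) else 0) * x v =
      phaseAngle x i := by
    intro i
    by_cases hi : i = r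
    · subst hi
      simpa using Finset.sum_eq_zero fun v _ => by simp [v.2]
    · rw [Finset.sum_eq_single ⟨i, hi⟩]
      · simp [phaseAngle, hi]
      · intro v _ hv
        rw [if_neg fun h => hv (Subtype.ext h), zero_mul]
      · simp
  unfold flowCoeff lineFlow
  split_ifs with h
  · simp only [mul_assoc, ← Finset.mul_sum, sub_mul, Finset.sum_sub_distrib, key]
  · simp

theorem dcMatrix_mulVec_flow (x : {v : V // v ≠ r} → ℝ) (i j : V) :
    (dcMatrix G B r).mulVec x (.flow i j) = lineFlow G B (phaseAngle x) i j :=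
  sum_flowCoeff_mul G B x i j

theorem dcMatrix_mulVec_inj (x : {v : V // v ≠ r} → ℝ) (i : V) :
    (dcMatrix G B r).mulVec x (.inj i) = ∑ j, lineFlow G B (phaseAngle x) i j := by
  simp only [← sum_flowCoeff_mul, Matrix.mulVec, dotProduct, dcMatrix, Finset.sum_mul]
  exact Finset.sum_comm

omit [Fintype V] in
theorem exists_polynomial_flowCoeff (i j v : V) :
    ∃ p : MvPolynomial G.edgeSet ℝ, ∀ B, MvPolynomial.eval B p = flowCoeff G B i j v := by
  by_cases h : G.Adj i j
  · exact ⟨MvPolynomial.X ⟨s(i, j), h⟩ *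
      MvPolynomial.C ((if v = i then 1 else 0) - (if v = j then 1 else 0)),
      fun B => by simp only [flowCoeff, dif_pos h, map_mul, MvPolynomial.eval_X, MvPolynomial.eval_C]⟩
  · exact ⟨0, fun B => by simp only [flowCoeff, dif_neg h, map_zero]⟩

theorem exists_polynomial_dcMatrix (r : V) (s : Sensor V) (v : {v : V // v ≠ r}) :
    ∃ p : MvPolynomial G.edgeSet ℝ, ∀ B, MvPolynomial.eval B p = dcMatrix G B r s v := by
  choose p hp using exists_polynomial_flowCoeff G
  cases s with
  | inj i => exact ⟨∑ j, p i j v, fun B => by simp [dcMatrix, hp]⟩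
  | flow i j => exact ⟨p i j v, fun B => by simp [dcMatrix, hp]⟩

end

/-! ### Generic susceptances and measured spanning trees -/

section

variable {V : Type*} [Fintype V] [DecidableEq V]

/-- Outside a proper algebraic set of line susceptances, sensors determine the state variables that
they determine for some susceptances. -/
theorem exists_generic_polynomial (G : SimpleGraph V) [DecidableRel G.Adj] :
    ∃ P : MvPolynomial G.edgeSet ℝ, P ≠ 0 ∧ ∀ B, MvPolynomial.eval B P ≠ 0 →
      ∀ (r : V) (X : Set {v : V // v ≠ r}) (Q : Set (Sensor V)) (B₀ : G.edgeSet → ℝ),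
        (∀ x, (∀ i ∉ X, x i = 0) → (∀ s ∈ Q, (dcMatrix G B₀ r).mulVec x s = 0) → x = 0) →
        ∀ x, (∀ i ∉ X, x i = 0) → (∀ s ∈ Q, (dcMatrix G B r).mulVec x s = 0) → x = 0 := by
  classical
  have single : ∀ t : (Σ r : V, Set {v : V // v ≠ r} × Set (Sensor V)),
      ∃ P : MvPolynomial G.edgeSet ℝ, P ≠ 0 ∧ ∀ B, MvPolynomial.eval B P ≠ 0 →
      ∀ B₀ : G.edgeSet → ℝ, (∀ x, (∀ i ∉ t.2.1, x i = 0) →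
        (∀ s ∈ t.2.2, (dcMatrix G B₀ t.1).mulVec x s = 0) → x = 0) →
        ∀ x, (∀ i ∉ t.2.1, x i = 0) →
          (∀ s ∈ t.2.2, (dcMatrix G B t.1).mulVec x s = 0) → x = 0 := by
    rintro ⟨r, X, Q⟩
    have := Fintype.ofFinite (Sensor V)
    -- The identity rows outside `X` encode the support condition, so that both conditions on `x`
    -- become one kernel.
    let M : (G.edgeSet → ℝ) → Matrix ((Q : Type _) ⊕ (Xᶜ : Set _)) {v : V // v ≠ r} ℝ :=
      fun B => Matrix.fromRows ((dcMatrix G B r).submatrix Subtype.val id)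
        ((1 : Matrix _ _ ℝ).submatrix Subtype.val id)
    have hM : ∀ B x, (M B).mulVec x = 0 ↔
        (∀ i ∉ X, x i = 0) ∧ ∀ s ∈ Q, (dcMatrix G B r).mulVec x s = 0 := by
      intro B x
      have h1 : ∀ i : (Xᶜ : Set _),
          (((1 : Matrix _ _ ℝ).submatrix Subtype.val id : Matrix (Xᶜ : Set _) _ ℝ).mulVec x) i
            = x i := fun i => by
        change (Matrix.mulVec 1 x) i.1 = _
        rw [Matrix.one_mulVec]
      simp only [M, Matrix.fromRows_mulVec, funext_iff, Sum.forall, Sum.elim_inl, Sum.elim_inr,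
        Pi.zero_apply, h1, Subtype.forall, and_comm, Set.mem_compl_iff]
      rfl
    obtain ⟨P, hP, h⟩ := exists_polynomial_forall_ker_trivial M (by
      rintro (s | i) v
      · exact exists_polynomial_dcMatrix G r s v
      · exact ⟨MvPolynomial.C ((1 : Matrix _ _ ℝ) i.1 v), fun B => by simp only [MvPolynomial.eval_C]; rfl⟩)
    refine ⟨P, hP, fun B hB B₀ h₀ x hx hs => ?_⟩
    exact h B hB B₀ (fun y hy => h₀ y ((hM B₀ y).1 hy).1 ((hM B₀ y).1 hy).2) x ((hM B x).2 ⟨hx, hs⟩)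
  choose P hP h using single
  -- Only finitely many triples `(r, X, Q)` exist, so a product gives one polynomial that depends on
  -- the topology alone.
  have := Fintype.ofFinite (Σ r : V, Set {v : V // v ≠ r} × Set (Sensor V))
  refine ⟨∏ t, P t, Finset.prod_ne_zero_iff.2 fun t _ => hP t, fun B hB r X Q => ?_⟩
  rw [map_prod, Finset.prod_ne_zero_iff] at hB
  exact h ⟨r, X, Q⟩ B (hB _ (Finset.mem_univ _))

/-- If a network has a measured spanning tree, then for the susceptances that are one on the tree
and zero elsewhere, the sensors determine the phase angles in the network. -/
theorem HasMeasuredSpanningTree.exists_susceptances {G : SimpleGraph V} [DecidableRel G.Adj]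
    {N : G.Subgraph} {Q : Set (Sensor V)} (h : HasMeasuredSpanningTree G N Q) {r : V}
    (hr : r ∈ N.verts) :
    ∃ B₀ : G.edgeSet → ℝ, ∀ x : {v : V // v ≠ r} → ℝ, (∀ i, i.1 ∉ N.verts → x i = 0) →
      (∀ s ∈ Q, (dcMatrix G B₀ r).mulVec x s = 0) → x = 0 := by
  classical
  obtain ⟨a, ha, T, -, hverts, hT, hmeas⟩ := h
  let B₀ : G.edgeSet → ℝ := fun e => if e.1 ∈ T.edgeSet then 1 else 0
  refine ⟨B₀, fun x hX hQ => ?_⟩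
  set θ := phaseAngle x with hθ
  have hflow : ∀ i j, lineFlow G B₀ θ i j = if T.Adj i j then θ i - θ j else 0 := by
    intro i j
    by_cases hij : T.Adj i j
    · simp [lineFlow, B₀, T.adj_sub hij, hij]
    · simp [lineFlow, B₀, hij]
  -- The forest of tree edges that carry nonzero flow; it must turn out to have no edges.
  let F : SimpleGraph T.verts :=
    { Adj := fun i j => T.Adj i j ∧ θ i ≠ θ j
      symm := ⟨fun _ _ h => ⟨h.1.symm, h.2.symm⟩⟩
      loopless := ⟨fun _ h => h.2 rfl⟩ }
  have hF : F.IsAcyclic := hT.isAcyclic.anti fun _ _ h => h.1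
  have hno : ∀ i j, ¬ F.Adj i j := by
    refine hF.not_adj_of_assignment (fun k j => Sensor.inj k.1 ∈ Q ∧ a k = s(k.1, j.1)) ?_ ?_ ?_
    · rintro ⟨i, hi⟩ ⟨j, hj⟩ ⟨hadj, hne⟩
      have hfl : ∀ i j, T.Adj i j → Sensor.flow i j ∈ Q → θ i = θ j := by
        intro i j hij hs
        have := hQ _ hs
        rwa [dcMatrix_mulVec_flow, hflow, if_pos hij, sub_eq_zero] at this
      rcases hmeas i j hadj with h | h | ⟨k, hk, hak⟩
      · exact absurd (hfl i j hadj h) hne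
      · exact absurd (hfl j i hadj.symm h).symm hne
      · have hmem := (ha k hk).2
        rw [hak, Sym2.mem_iff] at hmem
        rcases hmem with rfl | rfl
        · exact Or.inl ⟨hk, hak⟩
        · exact Or.inr ⟨hk, hak.trans Sym2.eq_swap⟩
    · rintro k i j ⟨-, hi⟩ ⟨-, hj⟩
      rw [hi, Sym2.congr_right] at hj
      exact Subtype.ext hj
    · rintro ⟨k, hk⟩ ⟨j, hj⟩ ⟨hadj, hne⟩ ⟨hs, -⟩
      -- If `k` were a leaf of `F`, its injection would equal the flow on its single edge in `F`,
      -- which is nonzero.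
      by_contra! hcon
      have hsum := hQ _ hs
      rw [dcMatrix_mulVec_inj, ← hθ, Finset.sum_eq_single j] at hsum
      · rw [hflow, if_pos hadj, sub_eq_zero] at hsum
        exact hne hsum
      · intro i _ hij
        rw [hflow]
        split_ifs with hki
        · by_contra hne'
          exact hcon ⟨i, T.edge_vert hki.symm⟩ (fun h => hij (congrArg Subtype.val h))
            ⟨hki, fun h => hne' (sub_eq_zero.2 h)⟩
        · rfl
      · simp
  have hconst : ∀ i j : T.verts, T.coe.Reachable i j → θ i = θ j := by
    rintro i j ⟨p⟩
    induction p with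
    | nil => rfl
    | cons h _ ih => exact (not_not.1 fun hne => hno _ _ ⟨h, hne⟩).trans ih
  funext v
  by_cases hv : v.1 ∈ N.verts
  · have := hconst ⟨v, hverts ▸ hv⟩ ⟨r, hverts ▸ hr⟩ (hT.connected.preconnected _ _)
    simpa [hθ] using this
  · exact hX v hv

end

/-! ### Linear algebra of partial-measurement attacks -/

section

variable {σ ι : Type*} [Fintype ι]

theorem rowsOf_mulVec_eq_zero_iff {κ : Type*} [Fintype κ] (H : Matrix σ κ ℝ) (S : Set σ)
    (x : κ → ℝ) : (rowsOf H S).mulVec x = 0 ↔ ∀ s ∈ S, H.mulVec x s = 0 :=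
  funext_iff.trans Subtype.forall

theorem isObservable_iff (H : Matrix σ ι ℝ) (S : Set σ) :
    IsObservable H S ↔ ∀ x, (∀ s ∈ S, H.mulVec x s = 0) → x = 0 := by
  simp only [← rowsOf_mulVec_eq_zero_iff]
  exact injective_iff_map_eq_zero (rowsOf H S).mulVecLin

theorem isObservableVars_iff (H : Matrix σ ι ℝ) (X : Set ι) (S : Set σ) :
    IsObservableVars H X S ↔ ∀ x, (∀ s ∈ S, H.mulVec x s = 0) → ∀ i ∈ X, x i = 0 := by
  simp only [IsObservableVars, rowsOf_mulVec_eq_zero_iff]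

theorem IsObservableVars.mono {H : Matrix σ ι ℝ} {X : Set ι} {S T : Set σ}
    (h : IsObservableVars H X S) (hST : S ⊆ T) : IsObservableVars H X T := by
  rw [isObservableVars_iff] at h ⊢
  exact fun x hx => h x fun s hs => hx s (hST hs)

theorem mulVec_congr_of_mem {H : Matrix σ ι ℝ} {S : Set σ} {x y : ι → ℝ}
    (h : ∀ i ∈ relevantVars H S, x i = y i) {s : σ} (hs : s ∈ S) :
    H.mulVec x s = H.mulVec y s := by
  refine Finset.sum_congr rfl fun i _ => ?_
  by_cases hi : H s i = 0
  · simp [hi]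
  · rw [h i ⟨s, hs, hi⟩]

/-- Observability of the relevant variables makes the kernel of the measurement map equal to that of
the restriction to these variables, so the two ranks agree. -/
theorem finrank_measurementSubspace {H : Matrix σ ι ℝ} {S : Set σ}
    (h : IsObservableVars H (relevantVars H S) S) :
    Module.finrank ℝ (measurementSubspace H S) = (relevantVars H S).ncard := by
  classical
  let g : (ι → ℝ) →ₗ[ℝ] (relevantVars H S → ℝ) := LinearMap.funLeft ℝ ℝ Subtype.val
  have hker : LinearMap.ker (rowsOf H S).mulVecLin = LinearMap.ker g := by
    ext x
    rw [LinearMap.mem_ker, Matrix.mulVecLin_apply, LinearMap.mem_ker]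
    refine ⟨fun hx => funext fun i => h x hx i i.2, fun hg => (rowsOf_mulVec_eq_zero_iff H S x).2 fun s hs => ?_⟩
    have hx : ∀ i ∈ relevantVars H S, x i = 0 := fun i hi => congrFun hg ⟨i, hi⟩
    rw [mulVec_congr_of_mem (y := 0) hx hs, Matrix.mulVec_zero, Pi.zero_apply]
  have hg : LinearMap.range g = ⊤ :=
    LinearMap.range_eq_top.2 (LinearMap.funLeft_surjective_of_injective _ _ _
      Subtype.val_injective)
  have h1 := (rowsOf H S).mulVecLin.finrank_range_add_finrank_ker
  have h2 := g.finrank_range_add_finrank_ker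
  rw [hg, finrank_top, Module.finrank_fintype_fun_eq_card, ← hker] at h2
  rw [measurementSubspace, ← Nat.card_coe_set_eq, Nat.card_eq_fintype_card]
  omega

theorem IsBasisMatrix.mulVec_injective {τ κ : Type*} [Fintype κ] {U : Matrix τ κ ℝ}
    {R : Submodule ℝ (τ → ℝ)} (h : IsBasisMatrix U R) : Function.Injective U.mulVec :=
  Matrix.mulVec_injective_iff.2 h.1

theorem IsBasisMatrix.range_mulVecLin {τ κ : Type*} [Fintype κ] {U : Matrix τ κ ℝ}
    {R : Submodule ℝ (τ → ℝ)} (h : IsBasisMatrix U R) : LinearMap.range U.mulVecLin = R := by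
  rw [Matrix.range_mulVecLin, h.2]

/-- Since `U` is injective, this carries dimension and attack vectors over to the null space of the
reduced basis matrix. -/
theorem IsBasisMatrix.map_ker {H : Matrix σ ι ℝ} {S C : Set σ} {κ : Type*} [Fintype κ]
    {U : Matrix S κ ℝ} (h : IsBasisMatrix U (measurementSubspace H S)) :
    (LinearMap.ker (rowsOf U {t : S | (t : σ) ∉ C}).mulVecLin).map U.mulVecLin =
      partialAttackSpace H S C := by
  ext b
  rw [Submodule.mem_map]
  change _ ↔ b ∈ measurementSubspace H S ∧ _
  rw [← h.range_mulVecLin]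
  constructor
  · rintro ⟨v, hv, rfl⟩
    exact ⟨⟨v, rfl⟩, (rowsOf_mulVec_eq_zero_iff U _ v).1 hv⟩
  · rintro ⟨⟨v, rfl⟩, hb⟩
    exact ⟨v, (rowsOf_mulVec_eq_zero_iff U _ v).2 hb, rfl⟩

/-- The attacks from partial measurements, for a general measurement matrix. -/
theorem partial_measurement_attack {H : Matrix σ ι ℝ} {S So C : Set σ} (hS : IsObservable H S)
    (hSo : So ⊆ S) (hC : C ⊆ So) (hSC : ¬ IsObservable H (S \ C))
    (hobs : ∀ s ∈ C, IsObservableVars H (relevantVars H So) ((So \ C) ∪ {s})) :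
    (IsObservableVars H (relevantVars H So) So ∧ IsCriticalSetFor H So (relevantVars H So) C ∧
        ¬ IsObservable H (S \ C)) ∧
      (Module.finrank ℝ (partialAttackSpace H So C) = 1 ∧
        ∀ b ∈ partialAttackSpace H So C, b ≠ 0 →
          IsUnobservableAttack H S C (attackOn S So C b)) ∧
      (∀ (k : ℕ) (U : Matrix So (Fin k) ℝ), IsBasisMatrix U (measurementSubspace H So) →
          k = (relevantVars H So).ncard ∧
          Module.finrank ℝ (LinearMap.ker
            (rowsOf U {t : So | (t : σ) ∉ C}).mulVecLin) = 1 ∧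
          ∀ v : Fin k → ℝ, v ≠ 0 → (rowsOf U {t : So | (t : σ) ∉ C}).mulVec v = 0 →
            IsUnobservableAttack H S C (attackOn S So C (U.mulVec v))) := by
  have hSC' := hSC
  rw [isObservable_iff] at hSC' hS
  push Not at hSC'
  obtain ⟨w, hw, hw0⟩ := hSC'
  -- Otherwise no sensor of `S` would see the nonzero state `w`.
  obtain ⟨s₀, hs₀, hws₀⟩ : ∃ s ∈ C, H.mulVec w s ≠ 0 := by
    by_contra! hcon
    exact hw0 (hS w fun s hs => by
      by_cases hsC : s ∈ C
      exacts [hcon s hsC, hw s ⟨hs, hsC⟩])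
  have hobsD : ∀ D : Set σ, D ⊂ C → IsObservableVars H (relevantVars H So) (So \ D) := by
    intro D hD
    obtain ⟨s, hs, hsD⟩ := Set.exists_of_ssubset hD
    refine (hobs s hs).mono (Set.union_subset (Set.sdiff_subset_sdiff_right hD.1) ?_)
    exact Set.singleton_subset_iff.2 ⟨hC hs, hsD⟩
  have hobsSo : IsObservableVars H (relevantVars H So) So :=
    (hobs s₀ hs₀).mono (Set.union_subset Set.sdiff_subset
      (Set.singleton_subset_iff.2 (hC hs₀)))
  have hcrit : ¬ IsObservableVars H (relevantVars H So) (So \ C) := by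
    rw [isObservableVars_iff]
    intro h
    refine hws₀ ?_
    rw [mulVec_congr_of_mem (y := 0) (h w fun s hs => hw s ⟨hSo hs.1, hs.2⟩) (hC hs₀)]
    simp
  -- A state that is zero on `So \ C` and at `s₀` vanishes on all relevant variables, by `hobs`.
  have hdim : ∀ b ∈ partialAttackSpace H So C, b ⟨s₀, hC hs₀⟩ = 0 → b = 0 := by
    rintro b ⟨⟨x, rfl⟩, hb⟩ hbs
    have hx := (isObservableVars_iff _ _ _).1 (hobs s₀ hs₀) x (by
      rintro s (⟨hs, hsC⟩ | rfl)
      exacts [hb ⟨s, hs⟩ hsC, hbs])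
    exact (rowsOf_mulVec_eq_zero_iff H So x).2 fun s hs => by
      rw [mulVec_congr_of_mem (y := 0) hx hs, Matrix.mulVec_zero, Pi.zero_apply]
  let b₀ : So → ℝ := (rowsOf H So).mulVec w
  have hb₀ : b₀ ∈ partialAttackSpace H So C :=
    ⟨⟨w, rfl⟩, fun s hs => hw s ⟨hSo s.2, hs⟩⟩
  have hspan : ∀ b ∈ partialAttackSpace H So C, ∃ c : ℝ, c • b₀ = b := by
    intro b hb
    refine ⟨b ⟨s₀, hC hs₀⟩ / H.mulVec w s₀, sub_eq_zero.1 (hdim _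
      (Submodule.sub_mem _ (Submodule.smul_mem _ _ hb₀) hb) ?_)⟩
    exact sub_eq_zero.2 (div_mul_cancel₀ _ hws₀)
  have hfin : Module.finrank ℝ (partialAttackSpace H So C) = 1 := by
    refine finrank_eq_one (⟨b₀, hb₀⟩ : partialAttackSpace H So C) ?_ ?_
    · exact fun h => hws₀ (congrFun (congrArg Subtype.val h) ⟨s₀, hC hs₀⟩)
    · rintro ⟨b, hb⟩
      obtain ⟨c, hc⟩ := hspan b hb
      exact ⟨c, Subtype.ext hc⟩
  have hattack : ∀ b ∈ partialAttackSpace H So C, b ≠ 0 →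
      IsUnobservableAttack H S C (attackOn S So C b) := by
    intro b hb hne
    obtain ⟨c, rfl⟩ := hspan b hb
    have hc : c ≠ 0 := by
      rintro rfl
      exact hne (zero_smul _ _)
    -- The entries extended by zero are consistent on all of `S`, since `w` is invisible to `S \ C`
    -- and not merely to `So \ C`.
    have hatt : attackOn S So C (c • b₀) = (rowsOf H S).mulVec (c • w) := by
      funext s
      rw [Matrix.mulVec_smul]
      by_cases hs : (s : σ) ∈ C
      · rw [attackOn, dif_pos ⟨hC hs, hs⟩]
        rfl
      · rw [attackOn, dif_neg fun h => hs h.2]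
        have : (rowsOf H S).mulVec w s = 0 := hw s ⟨s.2, hs⟩
        simp [this]
    refine ⟨fun s hs => dif_neg fun h => hs h.2, fun x e => ⟨x + c • w, ?_, ?_⟩⟩
    · simpa using ⟨hc, hw0⟩
    · rw [hatt, Matrix.mulVec_add, add_right_comm]
  refine ⟨⟨hobsSo, ⟨hC, hobsSo, hcrit, hobsD⟩, hSC⟩, ⟨hfin, hattack⟩, fun k U hU => ⟨?_, ?_, ?_⟩⟩
  · rw [← finrank_measurementSubspace hobsSo, ← hU.range_mulVecLin,
      LinearMap.finrank_range_of_inj hU.mulVec_injective, Module.finrank_fin_fun]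
  · rw [← hfin, ← hU.map_ker]
    exact (Submodule.equivMapOfInjective _ hU.mulVec_injective _).finrank_eq
  · intro v hv0 hv
    refine hattack _ (hU.map_ker ▸ Submodule.mem_map_of_mem hv) fun h => hv0 ?_
    exact hU.mulVec_injective (h.trans (Matrix.mulVec_zero U).symm)

end

/-! ### Cuts, reduced networks and the conclusion -/

section

variable {V : Type*} [Fintype V] [DecidableEq V]

theorem mem_reducedNetwork_of_mem_relevantVars {G : SimpleGraph V} [DecidableRel G.Adj]
    {B : G.edgeSet → ℝ} {r : V} {T : Set (Sensor V)} {v : {v : V // v ≠ r}}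
    (hv : v ∈ relevantVars (dcMatrix G B r) T) : v.1 ∈ (reducedNetwork G T).verts := by
  have key : ∀ i j, flowCoeff G B i j v ≠ 0 → G.Adj i j ∧ (v.1 = i ∨ v.1 = j) := by
    intro i j h
    unfold flowCoeff at h
    split_ifs at h with h1 h2 h3 h3 <;> simp_all
  obtain ⟨s, hs, hne⟩ := hv
  cases s with
  | inj i =>
    obtain ⟨j, -, hj⟩ := Finset.exists_ne_zero_of_sum_ne_zero hne
    obtain ⟨hadj, h | h⟩ := key i j hj
    · exact ⟨j, h ▸ hadj, by simp [h, hs]⟩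
    · exact ⟨i, h ▸ hadj.symm, by simp [hs]⟩
  | flow i j =>
    obtain ⟨hadj, h | h⟩ := key i j hne
    · exact ⟨j, h ▸ hadj, by simp [h, hs]⟩
    · exact ⟨i, h ▸ hadj.symm, by simp [h, hs]⟩

/-- Without the sensors that measure a cut, the phase angles of the side of the cut that does not
contain the reference bus can be shifted. -/
theorem not_isObservable_diff_cutSensors (G : SimpleGraph V) [DecidableRel G.Adj]
    (B : G.edgeSet → ℝ) (r : V) (S : Set (Sensor V)) {U : Set V} (hU : U.Nonempty)
    (hU' : Uᶜ.Nonempty) : ¬ IsObservable (dcMatrix G B r) (S \ cutSensors G S U) := by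
  classical
  -- `W` is the side without `r`, so its indicator respects the zero phase angle of the reference
  -- bus.
  obtain ⟨W, hrW, ⟨u, hu⟩, hW⟩ : ∃ W : Set V, r ∉ W ∧ W.Nonempty ∧
      ∀ i j, G.Adj i j → ¬ IsCutLine G U i j → (i ∈ W ↔ j ∈ W) := by
    by_cases hr : r ∈ U
    · exact ⟨Uᶜ, fun h => h hr, hU', fun i j h h' => by
        simp only [IsCutLine, Set.mem_compl_iff] at h' ⊢; tauto⟩
    · exact ⟨U, hr, hU, fun i j h h' => by simp only [IsCutLine] at h'; tauto⟩
  rw [isObservable_iff]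
  intro h
  let w : {v : V // v ≠ r} → ℝ := fun v => if v.1 ∈ W then 1 else 0
  have hθ : ∀ v, phaseAngle w v = if v ∈ W then 1 else 0 := by
    intro v
    by_cases hv : v = r
    · subst hv
      simp [hrW]
    · simp [phaseAngle, w, hv]
  have hflow : ∀ i j, ¬ IsCutLine G U i j → lineFlow G B (phaseAngle w) i j = 0 := by
    intro i j hij
    unfold lineFlow
    split_ifs with hadj
    · simp [hθ, hW i j hadj hij]
    · rfl
  have hw : w = 0 := by
    refine h w ?_
    rintro (i | ⟨i, j⟩) ⟨hs, hsC⟩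
    · rw [dcMatrix_mulVec_inj]
      exact Finset.sum_eq_zero fun j _ => hflow i j fun hij => hsC ⟨hs, j, hij⟩
    · rw [dcMatrix_mulVec_flow]
      exact hflow i j fun hij => hsC ⟨hs, hij⟩
  have := congrFun hw ⟨u, fun hur => hrW (hur ▸ hu)⟩
  simp [w, hu] at this

end

theorem mainTheorem4 {V : Type*} [Fintype V] [DecidableEq V]
    (G : SimpleGraph V) [DecidableRel G.Adj] :
    -- `P` is a nonzero polynomial in the line susceptances that depends only on the topology
    ∃ P : MvPolynomial G.edgeSet ℝ, P ≠ 0 ∧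
      ∀ B : G.edgeSet → ℝ, MvPolynomial.eval B P ≠ 0 →
      -- reference bus, deployed sensors, with an observable system
      ∀ (r : V) (S : Set (Sensor V)), IsObservable (dcMatrix G B r) S →
      ∀ So C : Set (Sensor V), So ⊆ S → C ⊆ So →
      r ∈ (reducedNetwork G So).verts →
      (∃ U : Set V, U.Nonempty ∧ Uᶜ.Nonempty ∧ C = cutSensors G S U) →
      (∀ s ∈ C, HasMeasuredSpanningTree G (reducedNetwork G So) ((So \ C) ∪ {s})) →
      -- the three conditions for the partial-measurement attack
      (IsObservableVars (dcMatrix G B r) (relevantVars (dcMatrix G B r) So) So ∧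
        IsCriticalSetFor (dcMatrix G B r) So (relevantVars (dcMatrix G B r) So) C ∧
        ¬ IsObservable (dcMatrix G B r) (S \ C)) ∧
      -- the attack from the subspace of partial measurements
      (Module.finrank ℝ (partialAttackSpace (dcMatrix G B r) So C) = 1 ∧
        ∀ b ∈ partialAttackSpace (dcMatrix G B r) So C, b ≠ 0 →
          IsUnobservableAttack (dcMatrix G B r) S C (attackOn S So C b)) ∧
      -- the attack from a basis matrix of this subspace
      (∀ (k : ℕ) (U : Matrix So (Fin k) ℝ),
        IsBasisMatrix U (measurementSubspace (dcMatrix G B r) So) →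
          k = (relevantVars (dcMatrix G B r) So).ncard ∧
          Module.finrank ℝ (LinearMap.ker
            (rowsOf U {t : So | (t : Sensor V) ∉ C}).mulVecLin) = 1 ∧
          ∀ v : Fin k → ℝ, v ≠ 0 → (rowsOf U {t : So | (t : Sensor V) ∉ C}).mulVec v = 0 →
            IsUnobservableAttack (dcMatrix G B r) S C (attackOn S So C (U.mulVec v))) := by
  classical
  obtain ⟨P, hP, hgen⟩ := exists_generic_polynomial G
  refine ⟨P, hP, fun B hB r S hS So C hSo hC hr hcut htree => ?_⟩
  obtain ⟨U, hU, hU', rfl⟩ := hcut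
  refine partial_measurement_attack hS hSo hC (not_isObservable_diff_cutSensors G B r S hU hU')
    fun s hs => ?_
  rw [isObservableVars_iff]
  intro x hx i hi
  obtain ⟨B₀, hB₀⟩ := (htree s hs).exists_susceptances hr
  have hsub : (So \ cutSensors G S U) ∪ {s} ⊆ So :=
    Set.union_subset Set.sdiff_subset (Set.singleton_subset_iff.2 (hC hs))
  -- The genericity statement needs a state supported on the reduced network; truncating `x` leaves
  -- the measurements of `So` unchanged.
  let y : {v : V // v ≠ r} → ℝ := fun v =>
    if v.1 ∈ (reducedNetwork G So).verts then x v else 0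
  have hy : ∀ v ∈ relevantVars (dcMatrix G B r) So, y v = x v := fun v hv =>
    if_pos (mem_reducedNetwork_of_mem_relevantVars hv)
  have hy0 : y = 0 := hgen B hB r {v | v.1 ∈ (reducedNetwork G So).verts} _ B₀ hB₀ y
    (fun v hv => if_neg hv) fun t ht => (mulVec_congr_of_mem hy (hsub ht)).trans (hx t ht)
  rw [← hy i hi, hy0, Pi.zero_apply]
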